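/- Let $\Lambda=\Lambda_0\oplus\Lambda_1$ be a finite-dimensional real associative unital $\mathbb Z/2$-graded algebra that is supercommutative, i.e. $ab=(-1)^{\sigma(a)\sigma(b)}ba$ for homogeneous $a,b$ of parities $\sigma(a),\sigma(b)$. Let $n,m\ge 0$ be integers. $(A_0)$ Let $(e_0=1,e_1,\dots,e_p)$ be a basis of $\Lambda_0$ with $\sum_{k=0}^p e_k^2=0$. $(A_1)$ Let $(\varepsilon_1,\dots,\varepsilon_q)$ be a basis of $\Lambda_1$, $1=s_1<s_2<\dots<s_r<s_{r+1}=q+1$ integers and $a_1,\dots,a_q\in\Lambda_0$ with $\varepsilon_j=a_j\varepsilon_{s_k}$ for $s_k\le j<s_{k+1}$, $a_{s_k}=1$ and $\sum_{j=s_k}^{s_{k+1}-1}a_j^2=0$ for $k=1,\dots,r$. (This condition is needed only if $m\ge 1$.) Write $x=(y_1,\dots,y_n,\theta_1,\dots,\theta_m)\in\Lambda_0^n\times\Lambda_1^m$ with $y_i=\sum_{j=0}^p y_i^je_j$, $\theta_l=\sum_{t=1}^q\theta_l^t\varepsilon_t$, and let $\|x\|^2=\sum_{i,j}(y_i^j)^2+\sum_{l,t}(\theta_l^t)^2$.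 Put $N=n(p+1)+qm$ and assume $N\ge 1$. Let $dV=dy_1^0\wedge\dots\wedge dy_1^p\wedge\dots\wedge dy_n^0\wedge\dots\wedge dy_n^p\wedge d\theta_1^1\wedge\dots\wedge d\theta_1^q\wedge\dots\wedge d\theta_m^1\wedge\dots\wedge d\theta_m^q$ define the orientation, and let $\widehat{dy_i^j}$, $\widehat{d\theta_l^t}$ denote the product $dV$ with the factor $dy_i^j$, resp. $d\theta_l^t$, omitted. On $\Lambda$-valued differential forms, the Cauchy–Riemann operator is $$d''=\sum_{i=1}^n\sum_{j=1}^p dy_i^j\wedge\Big(\frac{\partial}{\partial y_i^j}-e_j\frac{\partial}{\partial y_i^0}\Big)+\sum_{l=1}^m\sum_{k=1}^r\sum_{t=s_k+1}^{s_{k+1}-1}d\theta_l^t\wedge\Big(\frac{\partial}{\partial\theta_l^t}-a_t\frac{\partial}{\partial\theta_l^{s_k}}\Big).$$ Then the $\Lambda$-valued form of degree $N-1$ $$\Omega=\frac{c}{\|x\|^{N}}\Big[\sum_{i=1}^n\sum_{j=1}^p(-1)^{(p+1)(i-1)+j}(y_i^je_0+y_i^0e_j)\,\widehat{dy_i^j}+\sum_{l=1}^m\sum_{k=1}^r\sum_{t=s_k+1}^{s_{k+1}-1}(-1)^{n(p+1)+t-1}(\theta_l^te_0+\theta_l^{s_k}a_t)\,\widehat{d\theta_l^t}\Big],$$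 $$c=-\big(N\,\mathrm{Vol}(B(0,1))\big)^{-1},$$ where $\mathrm{Vol}(B(0,1))$ is the volume of the Euclidean unit ball of dimension $N$, is a fundamental solution of $d''$: its coefficients are locally integrable and $d''\Omega=[0]$ in the sense of currents, where $[0]$ is evaluation at the origin, an $(N-1)$-form acts on test 1-forms by $\langle\Omega,\alpha\rangle=\int\alpha\wedge\Omega$, and $\langle d''\Omega,\varphi\rangle=\langle\Omega,d''\varphi\rangle$. That is, for every smooth compactly supported $\varphi:\Lambda_0^n\times\Lambda_1^m\to\Lambda$, $$\int_{\Lambda_0^n\times\Lambda_1^m}d''\varphi\wedge\Omega=\varphi(0).$$ For $n=1$, $m=0$ this is the fundamental solution of $d''$ on $\Lambda_0$, under $(A_0)$ alone. -/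

import Mathlib

noncomputable section

namespace Superanalysis

/-- Supercommutativity of a `ZMod 2`-graded algebra: `a b = (-1)^{σ(a)σ(b)} b a` for homogeneous
`a`, `b`. -/
def IsSupercommutative {Λ : Type*} [Ring Λ] [Algebra ℝ Λ] (𝒜 : ZMod 2 → Submodule ℝ Λ) : Prop :=
  ∀ i j : ZMod 2, ∀ a ∈ 𝒜 i, ∀ b ∈ 𝒜 j, a * b = (-1) ^ (i.val * j.val) * (b * a)

/-- A finite sequence `0 = s₀ < s₁ < ⋯ < s_r = q`. It cuts `Fin q` into the `r` consecutive blocks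
`{t | s_k ≤ t < s_{k+1}}` (all indices start at `0`). -/
structure Blocks (q r : ℕ) where
  s : Fin (r + 1) → ℕ
  strictMono : StrictMono s
  first : s 0 = 0
  last : s (Fin.last r) = q

/-- The first index `s_k` of the `k`-th block. -/
def Blocks.head {q r : ℕ} (S : Blocks q r) (k : Fin r) : Fin q :=
  ⟨S.s k.castSucc, by
    have h1 : S.s k.castSucc < S.s k.succ := S.strictMono Fin.castSucc_lt_succ
    have h2 : S.s k.succ ≤ S.s (Fin.last r) := S.strictMono.monotone (Fin.le_last _)
    have h3 := S.last
    omega⟩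

/-- The `k`-th block `{t | s_k ≤ t < s_{k+1}}`. -/
def Blocks.block {q r : ℕ} (S : Blocks q r) (k : Fin r) : Finset (Fin q) :=
  Finset.univ.filter fun t => S.s k.castSucc ≤ (t : ℕ) ∧ (t : ℕ) < S.s k.succ

/-- The `k`-th block without its first index, `{t | s_k < t < s_{k+1}}`. -/
def Blocks.tail {q r : ℕ} (S : Blocks q r) (k : Fin r) : Finset (Fin q) :=
  Finset.univ.filter fun t => S.s k.castSucc < (t : ℕ) ∧ (t : ℕ) < S.s k.succ

section

variable {Λ : Type*} [NormedRing Λ] [NormedAlgebra ℝ Λ] [FiniteDimensional ℝ Λ]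
variable {𝒜 : ZMod 2 → Submodule ℝ Λ}

/-- Condition `(A₀)` for a basis `(e₀, …, e_p)` of `Λ₀`: `e₀ = 1` and `∑ e_k² = 0`. -/
def ConditionA0 {p : ℕ} (e : Module.Basis (Fin (p + 1)) ℝ (𝒜 0)) : Prop :=
  (e 0 : Λ) = 1 ∧ ∑ k, (e k : Λ) ^ 2 = 0

/-- Condition `(A₁)` for a basis `(ε_t)` of `Λ₁`, a cutting of its index set into blocks and
elements `a_t` of `Λ₀`: `ε_t = a_t ε_{s_k}` on the `k`-th block, `a_{s_k} = 1`, and the squares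
`a_t²` sum to zero over each block. -/
structure ConditionA1 {q r : ℕ} (ε : Module.Basis (Fin q) ℝ (𝒜 1)) (S : Blocks q r)
    (a : Fin q → 𝒜 0) : Prop where
  generate : ∀ k, ∀ t ∈ S.block k, (ε t : Λ) = (a t : Λ) * (ε (S.head k) : Λ)
  head_eq_one : ∀ k, (a (S.head k) : Λ) = 1
  sum_sq : ∀ k, ∑ t ∈ S.block k, (a t : Λ) ^ 2 = 0

/-- The superspace `Λ₀ⁿ × Λ₁ᵐ`. -/
abbrev Superspace (𝒜 : ZMod 2 → Submodule ℝ Λ) (n m : ℕ) : Type _ :=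
  (Fin n → 𝒜 0) × (Fin m → 𝒜 1)

/-- `Λ`-valued constant-coefficient exterior forms of degree `k` on `Λ₀ⁿ × Λ₁ᵐ`. -/
abbrev ExtForm (𝒜 : ZMod 2 → Submodule ℝ Λ) (n m k : ℕ) : Type _ :=
  Superspace 𝒜 n m [⋀^Fin k]→L[ℝ] Λ

/-- Labels of the real coordinates: `inl (i, j)` for `y_i^j`, `inr (l, t)` for `θ_l^t`. -/
abbrev Label (n m p q : ℕ) : Type := (Fin n × Fin (p + 1)) ⊕ (Fin m × Fin q)

/-- The enumeration `y_1^0, …, y_1^p, …, y_n^0, …, y_n^p, θ_1^1, …, θ_1^q, …, θ_m^1, …, θ_m^q` of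
the real coordinates, where `d + 1` is the real dimension of the superspace. -/
def position {n m p q d : ℕ} (hd : n * (p + 1) + m * q = d + 1) :
    Label n m p q ≃ Fin (d + 1) :=
  ((Equiv.sumCongr finProdFinEquiv finProdFinEquiv).trans finSumFinEquiv).trans (finCongr hd)

variable {n m p q r d : ℕ}

/-- The real coordinate functions `y_i^j` and `θ_l^t`; being linear, they are also the constant
1-forms `dy_i^j` and `dθ_l^t`. -/
def coord (e : Module.Basis (Fin (p + 1)) ℝ (𝒜 0)) (ε : Module.Basis (Fin q) ℝ (𝒜 1)) :
    Label n m p q → (Superspace 𝒜 n m →L[ℝ] ℝ)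
  | .inl (i, j) => LinearMap.toContinuousLinearMap
      (e.coord j ∘ₗ LinearMap.proj i ∘ₗ LinearMap.fst ℝ (Fin n → 𝒜 0) (Fin m → 𝒜 1))
  | .inr (l, t) => LinearMap.toContinuousLinearMap
      (ε.coord t ∘ₗ LinearMap.proj l ∘ₗ LinearMap.snd ℝ (Fin n → 𝒜 0) (Fin m → 𝒜 1))

/-- The vectors of the superspace dual to the coordinates. -/
def coordVec (e : Module.Basis (Fin (p + 1)) ℝ (𝒜 0)) (ε : Module.Basis (Fin q) ℝ (𝒜 1)) :
    Label n m p q → Superspace 𝒜 n m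
  | .inl (i, j) => (Pi.single i (e j), 0)
  | .inr (l, t) => (0, Pi.single l (ε t))

/-- The Euclidean norm on the superspace for which the bases `e` and `ε` are orthonormal. -/
def euclNorm (e : Module.Basis (Fin (p + 1)) ℝ (𝒜 0)) (ε : Module.Basis (Fin q) ℝ (𝒜 1))
    (x : Superspace 𝒜 n m) : ℝ :=
  √(∑ c : Label n m p q, coord e ε c x ^ 2)

/-- The point with given coordinates. -/
def point (e : Module.Basis (Fin (p + 1)) ℝ (𝒜 0)) (ε : Module.Basis (Fin q) ℝ (𝒜 1))
    (hd : n * (p + 1) + m * q = d + 1) (u : EuclideanSpace ℝ (Fin (d + 1))) : Superspace 𝒜 n m :=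
  ∑ b, u b • coordVec e ε ((position hd).symm b)

/-- The determinant as a continuous alternating map of the rows. -/
def detForm (k : ℕ) : (Fin k → ℝ) [⋀^Fin k]→L[ℝ] ℝ where
  toMultilinearMap := (Matrix.detRowAlternating (n := Fin k) (R := ℝ)).toMultilinearMap
  cont := Continuous.matrix_det (A := fun v : Fin k → Fin k → ℝ => Matrix.of v) continuous_id
  map_eq_zero_of_eq' := (Matrix.detRowAlternating (n := Fin k) (R := ℝ)).map_eq_zero_of_eq'

/-- The exterior product `f₀ ∧ ⋯ ∧ f_{k-1}` of real linear forms, `v ↦ det (f_b (v_c))`, as a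
`Λ`-valued form. -/
def wedgeList {k : ℕ} (f : Fin k → (Superspace 𝒜 n m →L[ℝ] ℝ)) : ExtForm 𝒜 n m k :=
  (algebraMapCLM ℝ Λ).compContinuousAlternatingMap
    ((detForm k).compContinuousLinearMap (ContinuousLinearMap.pi f))

/-- The form `dx̂_c`: the exterior product, in the order of `position`, of the differentials of all
real coordinates except the one labelled `c`. -/
def hatForm (e : Module.Basis (Fin (p + 1)) ℝ (𝒜 0)) (ε : Module.Basis (Fin q) ℝ (𝒜 1))
    (hd : n * (p + 1) + m * q = d + 1) (c : Label n m p q) : ExtForm 𝒜 n m d :=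
  wedgeList fun b => coord e ε ((position hd).symm ((position hd c).succAbove b))

/-- The exterior product `ℓ ∧ ω` of a 1-form `ℓ` with a form `ω`:
`(v₀, …, v_k) ↦ ∑ (-1)^i ℓ(v_i) ω(v₀, …, v̂_i, …, v_k)`, the product being that of `Λ`. -/
def wedgeOne {k : ℕ} (l : Superspace 𝒜 n m →L[ℝ] Λ) (ω : ExtForm 𝒜 n m k) :
    ExtForm 𝒜 n m (k + 1) :=
  ContinuousAlternatingMap.alternatizeUncurryFin (𝕜 := ℝ) (E := Superspace 𝒜 n m) (F := Λ)
    (LinearMap.toContinuousLinearMap (l.toLinearMap.smulRight ω))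

/-- The constant 1-form `dx_c`, with values in `Λ`. -/
def dcoord (e : Module.Basis (Fin (p + 1)) ℝ (𝒜 0)) (ε : Module.Basis (Fin q) ℝ (𝒜 1))
    (c : Label n m p q) : Superspace 𝒜 n m →L[ℝ] Λ :=
  (algebraMapCLM ℝ Λ).comp (coord e ε c)

/-- The partial derivative `∂ω/∂x_c` of a differential form, coefficient by coefficient. -/
def partialForm {k : ℕ} (e : Module.Basis (Fin (p + 1)) ℝ (𝒜 0))
    (ε : Module.Basis (Fin q) ℝ (𝒜 1)) (c : Label n m p q)
    (ω : Superspace 𝒜 n m → ExtForm 𝒜 n m k) (x : Superspace 𝒜 n m) : ExtForm 𝒜 n m k :=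
  fderiv ℝ ω x (coordVec e ε c)

/-- The Cauchy–Riemann operator
`d'' ω = ∑_{i, j ≥ 1} dy_i^j ∧ (∂ω/∂y_i^j - e_j ∂ω/∂y_i^0)
  + ∑_{l, k} ∑_{s_k < t < s_{k+1}} dθ_l^t ∧ (∂ω/∂θ_l^t - a_t ∂ω/∂θ_l^{s_k})`
on `Λ`-valued differential forms. -/
def dbar {k : ℕ} (e : Module.Basis (Fin (p + 1)) ℝ (𝒜 0)) (ε : Module.Basis (Fin q) ℝ (𝒜 1))
    (S : Blocks q r) (a : Fin q → 𝒜 0)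
    (ω : Superspace 𝒜 n m → ExtForm 𝒜 n m k) (x : Superspace 𝒜 n m) :
    ExtForm 𝒜 n m (k + 1) :=
  (∑ i : Fin n, ∑ j : Fin p,
      wedgeOne (dcoord e ε (.inl (i, j.succ)))
        (partialForm e ε (.inl (i, j.succ)) ω x
          - (e j.succ : Λ) • partialForm e ε (.inl (i, 0)) ω x))
    + ∑ l : Fin m, ∑ k' : Fin r, ∑ t ∈ S.tail k',
      wedgeOne (dcoord e ε (.inr (l, t)))
        (partialForm e ε (.inr (l, t)) ω x
          - (a t : Λ) • partialForm e ε (.inr (l, S.head k')) ω x)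

/-- A `Λ`-valued function as a differential form of degree `0`. -/
def zeroForm (φ : Superspace 𝒜 n m → Λ) (x : Superspace 𝒜 n m) : ExtForm 𝒜 n m 0 :=
  ContinuousAlternatingMap.constOfIsEmpty ℝ (Superspace 𝒜 n m) (Fin 0) (φ x)

/-- The integral `∫ η` of a form of top degree, for the orientation
`dV = dy_1^0 ∧ ⋯ ∧ dy_n^p ∧ dθ_1^1 ∧ ⋯ ∧ dθ_m^q`: the Lebesgue integral, in the coordinates, of the
coefficient of `η` in front of `dV`. -/
def integralForm (e : Module.Basis (Fin (p + 1)) ℝ (𝒜 0)) (ε : Module.Basis (Fin q) ℝ (𝒜 1))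
    (hd : n * (p + 1) + m * q = d + 1) (η : Superspace 𝒜 n m → ExtForm 𝒜 n m (d + 1)) : Λ :=
  ∫ u : EuclideanSpace ℝ (Fin (d + 1)),
    η (point e ε hd u) fun b => coordVec e ε ((position hd).symm b)

/-- The current defined by a form `ω` of degree `d = dim - 1`, acting on test 1-forms by
`⟨ω, α⟩ = ∫ α ∧ ω`. -/
def currentOf (e : Module.Basis (Fin (p + 1)) ℝ (𝒜 0)) (ε : Module.Basis (Fin q) ℝ (𝒜 1))
    (hd : n * (p + 1) + m * q = d + 1) (ω : Superspace 𝒜 n m → ExtForm 𝒜 n m d)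
    (α : Superspace 𝒜 n m → ExtForm 𝒜 n m 1) : Λ :=
  integralForm e ε hd fun x =>
    wedgeOne ((ContinuousAlternatingMap.ofSubsingleton ℝ (Superspace 𝒜 n m) Λ 0).symm (α x)) (ω x)

/-- The operator `d''` on currents of dimension 1, `⟨d''T, φ⟩ = ⟨T, d''φ⟩`. -/
def dbarCurrent (e : Module.Basis (Fin (p + 1)) ℝ (𝒜 0)) (ε : Module.Basis (Fin q) ℝ (𝒜 1))
    (S : Blocks q r) (a : Fin q → 𝒜 0)
    (T : (Superspace 𝒜 n m → ExtForm 𝒜 n m 1) → Λ) (φ : Superspace 𝒜 n m → Λ) : Λ :=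
  T (dbar e ε S a (zeroForm φ))

/-- The current `[0]` of evaluation at the origin. -/
def evalCurrent (φ : Superspace 𝒜 n m → Λ) : Λ := φ 0

/-- `ω` is a fundamental solution of `d''`: its coefficients are locally integrable, so that it
defines a current, and `d''ω = [0]` as currents, tested against all smooth compactly supported
`Λ`-valued functions. -/
structure IsFundamentalSolution (e : Module.Basis (Fin (p + 1)) ℝ (𝒜 0))
    (ε : Module.Basis (Fin q) ℝ (𝒜 1)) (S : Blocks q r) (a : Fin q → 𝒜 0)
    (hd : n * (p + 1) + m * q = d + 1) (ω : Superspace 𝒜 n m → ExtForm 𝒜 n m d) : Prop where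
  locallyIntegrable : ∀ v : Fin d → Superspace 𝒜 n m, MeasureTheory.LocallyIntegrable
    fun u : EuclideanSpace ℝ (Fin (d + 1)) => ω (point e ε hd u) v
  dbar_eq : ∀ φ : Superspace 𝒜 n m → Λ, ContDiff ℝ (⊤ : ℕ∞) φ → HasCompactSupport φ →
    dbarCurrent e ε S a (currentOf e ε hd ω) φ = evalCurrent φ

/-- The constant `c = -((n(p+1) + qm) Vol(B(0,1)))⁻¹`, the unit ball being that of the Euclidean
space of dimension `d + 1 = n(p+1) + qm`. -/
def fundConst (n m p q d : ℕ) : ℝ :=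
  -(((n * (p + 1) + q * m : ℕ) : ℝ) *
    MeasureTheory.volume.real (Metric.ball (0 : EuclideanSpace ℝ (Fin (d + 1))) 1))⁻¹

/-- The form `Ω = c ‖x‖^{-(n(p+1)+qm)} [ ∑_{i, j ≥ 1} (-1)^{(p+1)(i-1)+j} (y_i^j + y_i^0 e_j) dŷ_i^j
  + ∑_{l, k} ∑_{s_k < t < s_{k+1}} (-1)^{n(p+1)+t-1} (θ_l^t + θ_l^{s_k} a_t) dθ̂_l^t ]`.
In the code the indices `i`, `l`, `t` start at `0`. -/
def fundForm (e : Module.Basis (Fin (p + 1)) ℝ (𝒜 0)) (ε : Module.Basis (Fin q) ℝ (𝒜 1))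
    (S : Blocks q r) (a : Fin q → 𝒜 0) (hd : n * (p + 1) + m * q = d + 1)
    (x : Superspace 𝒜 n m) : ExtForm 𝒜 n m d :=
  (fundConst n m p q d / euclNorm e ε x ^ (n * (p + 1) + q * m)) •
    ((∑ i : Fin n, ∑ j : Fin p,
        (-1 : ℝ) ^ ((p + 1) * (i : ℕ) + (j.succ : ℕ)) •
          ((coord e ε (.inl (i, j.succ)) x • (1 : Λ)
              + coord e ε (.inl (i, 0)) x • (e j.succ : Λ)) •
            hatForm e ε hd (.inl (i, j.succ))))
      + ∑ l : Fin m, ∑ k : Fin r, ∑ t ∈ S.tail k,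
        (-1 : ℝ) ^ (n * (p + 1) + (t : ℕ)) •
          ((coord e ε (.inr (l, t)) x • (1 : Λ)
              + coord e ε (.inr (l, S.head k)) x • (a t : Λ)) •
            hatForm e ε hd (.inr (l, t))))

end

end Superanalysis

end

/-! Pairing `d''φ` with `Ω` leaves one scalar density. On a coordinate vector, `d''φ` gives `D_j -
e_j D_0`, where `D_j` denotes a partial derivative of `φ`, and the signs in `Ω` cancel those of
moving each differential to its place in `dV`. The density is thus `c ‖x‖^(-N)` times the sum of the
products `(D_j - e_j D_0)(x_j + x_0 e_j)`, taken over the blocks of coordinates. Even elements are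
central and `∑ e_j² = -1` over `j ≥ 1` (likewise for `a_t` on each odd block), so every block
collapses to its Euler field `∑ x_j D_j` plus the terms `e_j (x_0 D_j - x_j D_0)`, which are
rotations with constant coefficients (`sum_cauchyRiemann_mul`, `wedge_dbar_fundForm`).

The Euler part is a radial derivative: in polar coordinates each ray contributes `-φ(0)`, and the
mass of the sphere, `N Vol(B(0,1))`, is cancelled by `c` (`integral_inv_norm_pow_smul_fderiv_self`).
The rotations contribute nothing, because they preserve the radial weight
(`integral_inv_norm_pow_smul_rotation`).

One sign is subtle. The place of `dθ_l^t` in `dV` involves a multiple of `q` that the exponent in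
`Ω` omits, so `q` has to be even. It is: `Λ₁` is a module over `Λ₀`, where `-1` is a sum of squares,
hence every simple quotient met in a filtration of `Λ₁` is a complex line
(`ConditionA0.even_odd_dim`). -/

noncomputable section


/-! ### Parity of the dimension of the odd part. -/

namespace Superanalysis

/-- A commutative real algebra in which `1` plus a sum of squares vanishes has no real character,
so that all its finite-dimensional simple modules are complex lines. -/
theorem even_finrank_of_isSimpleModule {R : Type*} [CommRing R] [Algebra ℝ R] {ι : Type*}
    [Fintype ι] (x : ι → R) (hx : 1 + ∑ i, x i ^ 2 = 0) (M : Type*) [AddCommGroup M] [Module ℝ M]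
    [Module R M] [IsScalarTower ℝ R M] [FiniteDimensional ℝ M] [IsSimpleModule R M] :
    Even (Module.finrank ℝ M) := by
  obtain ⟨I, hI, ⟨f⟩⟩ := isSimpleModule_iff_quot_maximal.mp (inferInstance : IsSimpleModule R M)
  let _ := Ideal.Quotient.field I
  let g : M ≃ₗ[ℝ] (R ⧸ I) := f.restrictScalars ℝ
  have : FiniteDimensional ℝ (R ⧸ I) := Module.Finite.equiv g
  rw [g.finrank_eq]
  rcases Real.nonempty_algEquiv_or (R ⧸ I) with ⟨⟨h⟩⟩ | ⟨⟨h⟩⟩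
  · exfalso
    have h1 := congrArg (fun z => h (Ideal.Quotient.mkₐ ℝ I z)) hx
    simp only [map_add, map_one, map_sum, map_pow, map_zero] at h1
    have h2 : 0 ≤ ∑ i, (h (Ideal.Quotient.mkₐ ℝ I (x i))) ^ 2 :=
      Finset.sum_nonneg fun i _ => sq_nonneg _
    linarith
  · rw [h.toLinearEquiv.finrank_eq, Complex.finrank_real_complex]
    exact even_two

/-- Dimension is additive along a composition series: a maximal submodule splits off a simple
quotient of even dimension, and induction applies to the submodule. -/
theorem even_finrank_of_one_add_sum_sq {R : Type*} [CommRing R] [Algebra ℝ R] {ι : Type*}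
    [Fintype ι] (x : ι → R) (hx : 1 + ∑ i, x i ^ 2 = 0) (M : Type*) [AddCommGroup M] [Module ℝ M]
    [Module R M] [IsScalarTower ℝ R M] [FiniteDimensional ℝ M] :
    Even (Module.finrank ℝ M) := by
  induction h : Module.finrank ℝ M using Nat.strong_induction_on generalizing M with
  | _ k ih =>
    subst h
    have : Module.Finite R M := Module.Finite.of_restrictScalars_finite ℝ R M
    rcases subsingleton_or_nontrivial M with hM | hM
    · rw [Module.finrank_zero_of_subsingleton]
      exact Even.zero
    · obtain ⟨N, hN⟩ := IsCoatomic.exists_coatom (Submodule R M)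
      have : IsSimpleModule R (M ⧸ N) := isSimpleModule_iff_isCoatom.mpr hN
      have : FiniteDimensional ℝ (M ⧸ N) :=
        inferInstanceAs (FiniteDimensional ℝ (M ⧸ N.restrictScalars ℝ))
      have : FiniteDimensional ℝ N :=
        inferInstanceAs (FiniteDimensional ℝ (N.restrictScalars ℝ))
      have hsum : Module.finrank ℝ (M ⧸ N) + Module.finrank ℝ N = Module.finrank ℝ M :=
        Submodule.finrank_quotient_add_finrank (N.restrictScalars ℝ)
      have hq := even_finrank_of_isSimpleModule x hx (M ⧸ N)
      have : Nontrivial (M ⧸ N) := IsSimpleModule.nontrivial R (M ⧸ N)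
      have hpos : 0 < Module.finrank ℝ (M ⧸ N) := Module.finrank_pos
      rw [← hsum]
      exact hq.add (ih _ (by omega) N rfl)

open scoped IsMulCommutative in
/-- Commuting endomorphisms whose squares sum to `-1` exist only in even dimension. -/
theorem even_finrank_of_commuting {V : Type*} [AddCommGroup V] [Module ℝ V]
    [FiniteDimensional ℝ V] {ι : Type*} [Fintype ι] (T : ι → Module.End ℝ V)
    (hT : ∀ i j, T i * T j = T j * T i) (hs : 1 + ∑ i, T i ^ 2 = 0) :
    Even (Module.finrank ℝ V) := by
  have : IsMulCommutative (Algebra.adjoin ℝ (Set.range T)) :=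
    Algebra.isMulCommutative_adjoin ℝ (by rintro _ ⟨i, rfl⟩ _ ⟨j, rfl⟩; exact hT i j)
  refine even_finrank_of_one_add_sum_sq (R := Algebra.adjoin ℝ (Set.range T))
    (fun i => ⟨T i, Algebra.subset_adjoin ⟨i, rfl⟩⟩) ?_ V
  apply Subtype.ext
  have h := map_sum (Algebra.adjoin ℝ (Set.range T)).val
    (fun i => (⟨T i, Algebra.subset_adjoin ⟨i, rfl⟩⟩ : Algebra.adjoin ℝ (Set.range T)) ^ 2)
    Finset.univ
  exact (congrArg (1 + ·) h).trans hs

section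

variable {Λ : Type*} [NormedRing Λ] [NormedAlgebra ℝ Λ]
variable {𝒜 : ZMod 2 → Submodule ℝ Λ} [GradedAlgebra 𝒜]

theorem IsSupercommutative.commute_of_even (hsc : IsSupercommutative 𝒜) {x : Λ} (hx : x ∈ 𝒜 0)
    (y : Λ) : x * y = y * x := by
  have h0 : ∀ i, ∀ z ∈ 𝒜 i, x * z = z * x := fun i z hz => by
    simpa using hsc 0 i x hx z hz
  induction y using DirectSum.Decomposition.inductionOn 𝒜 with
  | zero => simp
  | homogeneous z => exact h0 _ _ z.2
  | add y z hy hz => rw [mul_add, add_mul, hy, hz]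

/-- Left multiplication by an even element, as an endomorphism of the odd part. -/
def oddMulLeft (x : 𝒜 0) : Module.End ℝ (𝒜 1) where
  toFun v := ⟨(x : Λ) * v, by simpa using SetLike.mul_mem_graded x.2 v.2⟩
  map_add' v w := Subtype.ext (mul_add _ _ _)
  map_smul' c v := Subtype.ext (mul_smul_comm _ _ _)

/-- Multiplications by the `e_j`, `j ≥ 1`, commute on `Λ₁`, and their squares sum to `-1` because
`e_0 = 1`. This parity is what makes the signs of the odd terms of `Ω` correct for every `l`. -/
theorem ConditionA0.even_odd_dim [FiniteDimensional ℝ Λ] (hsc : IsSupercommutative 𝒜) {p q : ℕ}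
    {e : Module.Basis (Fin (p + 1)) ℝ (𝒜 0)} (hA0 : ConditionA0 e)
    (ε : Module.Basis (Fin q) ℝ (𝒜 1)) : Even q := by
  rw [← Fintype.card_fin q, ← Module.finrank_eq_card_basis ε]
  refine even_finrank_of_commuting (fun j : Fin p => oddMulLeft (e j.succ)) (fun i j => ?_) ?_
  · ext v
    change (e i.succ : Λ) * ((e j.succ : Λ) * v) = (e j.succ : Λ) * ((e i.succ : Λ) * v)
    rw [← mul_assoc, ← mul_assoc, hsc.commute_of_even (e i.succ).2]
  · ext v
    have h := hA0.2
    rw [Fin.sum_univ_succ, hA0.1, one_pow] at h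
    have h2 := congrArg (· * (v : Λ)) h
    simp only [add_mul, one_mul, zero_mul, Finset.sum_mul] at h2
    simp only [LinearMap.add_apply, Module.End.one_apply, LinearMap.sum_apply, Submodule.coe_add,
      Submodule.coe_sum, LinearMap.zero_apply, Submodule.coe_zero]
    rw [← h2]
    congr 1
    refine Finset.sum_congr rfl fun j _ => ?_
    rw [pow_two, pow_two, mul_assoc]
    rfl

end

end Superanalysis

end

namespace Superanalysis

open MeasureTheory Set Metric Filter Topology

/-! ### Polar coordinates for vector-valued functions. -/

section Polar

variable {E F : Type*} [NormedAddCommGroup E] [NormedSpace ℝ E] [MeasurableSpace E]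
  [BorelSpace E] [FiniteDimensional ℝ E] [Nontrivial E] [NormedAddCommGroup F] [NormedSpace ℝ F]

/-- Integration in polar coordinates. -/
theorem integral_eq_integral_sphere_integral_Ioi (μ : Measure E) [μ.IsAddHaarMeasure] {f : E → F}
    (hf : Integrable f μ) :
    ∫ x, f x ∂μ = ∫ σ : sphere (0 : E) 1, (∫ r in Ioi (0 : ℝ),
      r ^ (Module.finrank ℝ E - 1) • f (r • (σ : E))) ∂μ.toSphere := by
  have hmp := μ.measurePreserving_homeomorphUnitSphereProd
  have hemb := (homeomorphUnitSphereProd E).measurableEmbedding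
  let g : sphere (0 : E) 1 × Ioi (0 : ℝ) → F := fun z => f ((z.2 : ℝ) • (z.1 : E))
  have hg : ∀ x : ({0}ᶜ : Set E), g (homeomorphUnitSphereProd E x) = f x := by
    intro x
    have hx : ‖(x : E)‖ ≠ 0 := norm_ne_zero_iff.2 x.2
    simp [g, smul_smul, hx]
  have hint : Integrable g (μ.toSphere.prod (.volumeIoiPow (Module.finrank ℝ E - 1))) := by
    rw [← hmp.integrable_comp_emb hemb]
    have : g ∘ homeomorphUnitSphereProd E = f ∘ Subtype.val := funext hg
    rw [this, ← integrableOn_iff_comap_subtypeVal (measurableSet_singleton _).compl]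
    exact hf.integrableOn
  calc
    ∫ x, f x ∂μ = ∫ x : ({(0)}ᶜ : Set E), f x.1 ∂(μ.comap (↑)) := by
      rw [integral_subtype_comap (measurableSet_singleton _).compl f,
        restrict_compl_singleton]
    _ = ∫ z, g z ∂μ.toSphere.prod (.volumeIoiPow (Module.finrank ℝ E - 1)) := by
      rw [← hmp.integral_comp hemb]
      exact integral_congr_ae (.of_forall fun x => (hg x).symm)
    _ = ∫ σ : sphere (0 : E) 1, ∫ r : Ioi (0 : ℝ), f ((r : ℝ) • (σ : E))
          ∂.volumeIoiPow (Module.finrank ℝ E - 1) ∂μ.toSphere := integral_prod _ hint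
    _ = _ := by
      refine integral_congr_ae (.of_forall fun σ => ?_)
      simp only [Measure.volumeIoiPow, ENNReal.ofReal]
      rw [integral_withDensity_eq_integral_smul,
        integral_subtype_comap measurableSet_Ioi
          fun a => Real.toNNReal (a ^ (Module.finrank ℝ E - 1)) • f (a • (σ : E)),
        setIntegral_congr_fun measurableSet_Ioi fun x hx => ?_]
      · rw [NNReal.smul_def, Real.coe_toNNReal _ (pow_nonneg hx.out.le _)]
      · exact (measurable_subtype_coe.pow_const _).real_toNNReal

end Polar

/-! ### The singular weight `‖x‖⁻ᴺ` against the Euler field and rotations. -/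

section Kernel

variable {E F : Type*} [NormedAddCommGroup E] [InnerProductSpace ℝ E] [MeasurableSpace E]
  [BorelSpace E] [FiniteDimensional ℝ E] [NormedAddCommGroup F] [NormedSpace ℝ F]

/-- The polar Jacobian `r ^ (dim E - 1)` cancels the singularity exactly. -/
theorem locallyIntegrable_inv_norm_pow [Nontrivial E] (μ : Measure E) [μ.IsAddHaarMeasure] :
    LocallyIntegrable (fun u : E => (‖u‖ ^ (Module.finrank ℝ E - 1))⁻¹) μ := by
  intro x
  refine ⟨ball 0 (‖x‖ + 1), isOpen_ball.mem_nhds (by simp), ?_⟩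
  rw [integrableOn_fun_norm_addHaar (E := E) μ
    (f := fun y : ℝ => (y ^ (Module.finrank ℝ E - 1))⁻¹)]
  refine (integrableOn_congr_fun (fun y hy => ?_) measurableSet_Ioo).mpr
    (integrableOn_const (C := (1 : ℝ)) (by simp))
  have : y ≠ 0 := hy.1.ne'
  simp [this]

/-- A linear field divided by the norm to the power of the dimension is locally integrable. -/
theorem locallyIntegrable_inv_norm_pow_smul [Nontrivial E] (μ : Measure E) [μ.IsAddHaarMeasure]
    (A : E →L[ℝ] F) : LocallyIntegrable (fun u : E => (‖u‖ ^ Module.finrank ℝ E)⁻¹ • A u) μ := by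
  have hpos : 0 < Module.finrank ℝ E := Module.finrank_pos
  refine ((locallyIntegrable_inv_norm_pow μ).smul ‖A‖).mono
    ((by fun_prop : Measurable fun u : E => (‖u‖ ^ Module.finrank ℝ E)⁻¹).aestronglyMeasurable.smul
      A.continuous.aestronglyMeasurable) (.of_forall fun u => ?_)
  rcases eq_or_ne u 0 with rfl | hu
  · rw [map_zero, smul_zero, norm_zero]
    exact norm_nonneg _
  have hn : 0 < ‖u‖ := norm_pos_iff.2 hu
  obtain ⟨k, hk⟩ := Nat.exists_eq_succ_of_ne_zero hpos.ne'
  simp only [Pi.smul_apply, smul_eq_mul, norm_mul, norm_smul, norm_inv, norm_pow, norm_norm]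
  rw [hk, Nat.succ_sub_one, pow_succ, inv_mul_le_iff₀ (by positivity)]
  refine (A.le_opNorm u).trans (le_of_eq ?_)
  field_simp

theorem integrable_inv_norm_pow_smul_inner [Nontrivial E] (μ : Measure E) [μ.IsAddHaarMeasure]
    (v : E) {g : E → F} (hg : Continuous g) (hc : HasCompactSupport g) :
    Integrable (fun u : E => (‖u‖ ^ Module.finrank ℝ E)⁻¹ • inner ℝ v u • g u) μ := by
  have h := (locallyIntegrable_inv_norm_pow_smul μ
    (innerSL ℝ v)).integrable_smul_right_of_hasCompactSupport hg hc
  refine h.congr (.of_forall fun u => ?_)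
  simp only [innerSL_apply_apply, smul_eq_mul, smul_smul]

theorem integrable_inv_norm_pow_smul_inner_smul_fderiv [Nontrivial E] (μ : Measure E)
    [μ.IsAddHaarMeasure] {ψ : E → F} (hψ : ContDiff ℝ 1 ψ) (hc : HasCompactSupport ψ) (v w : E) :
    Integrable (fun u : E => (‖u‖ ^ Module.finrank ℝ E)⁻¹ • inner ℝ v u • fderiv ℝ ψ u w) μ :=
  integrable_inv_norm_pow_smul_inner μ v
    ((hψ.continuous_fderiv one_ne_zero).clm_apply continuous_const) (hc.fderiv_apply ℝ w)

theorem integrable_inv_norm_pow_smul_fderiv_self [Nontrivial E] (μ : Measure E)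
    [μ.IsAddHaarMeasure] {ψ : E → F} (hψ : ContDiff ℝ 1 ψ) (hc : HasCompactSupport ψ) :
    Integrable (fun u => (‖u‖ ^ Module.finrank ℝ E)⁻¹ • fderiv ℝ ψ u u) μ := by
  let B := stdOrthonormalBasis ℝ E
  have h := integrable_finsetSum Finset.univ fun b _ =>
    integrable_inv_norm_pow_smul_inner_smul_fderiv μ hψ hc (B b) (B b)
  refine h.congr (.of_forall fun u => ?_)
  simp only [← Finset.smul_sum, ← map_smul, ← map_sum, B.sum_repr']

/-- The Euler field divided by the norm to the power of the dimension is, up to a constant, a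
fundamental solution of the divergence. -/
theorem integral_inv_norm_pow_smul_fderiv_self [Nontrivial E] (μ : Measure E) [μ.IsAddHaarMeasure]
    [CompleteSpace F] {ψ : E → F} (hψ : ContDiff ℝ 1 ψ) (hc : HasCompactSupport ψ) :
    ∫ u, (‖u‖ ^ Module.finrank ℝ E)⁻¹ • fderiv ℝ ψ u u ∂μ
      = -((Module.finrank ℝ E * μ.real (ball 0 1)) • ψ 0) := by
  have hpos : 0 < Module.finrank ℝ E := Module.finrank_pos
  rw [integral_eq_integral_sphere_integral_Ioi μ
    (integrable_inv_norm_pow_smul_fderiv_self μ hψ hc)]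
  -- On a ray the powers of `r` cancel, since `r ^ (N - 1) * r ^ (-N) * r = 1`. What remains is the
  -- derivative of `r ↦ ψ (r σ)`, which has compact support, so only the endpoint `r = 0`
  -- contributes.
  have key : ∀ σ : sphere (0 : E) 1, ∫ r in Ioi (0 : ℝ), r ^ (Module.finrank ℝ E - 1) •
      ((‖r • (σ : E)‖ ^ Module.finrank ℝ E)⁻¹ • fderiv ℝ ψ (r • (σ : E)) (r • (σ : E)))
      = -ψ 0 := by
    intro σ
    have hσ : ‖(σ : E)‖ = 1 := by simp
    let h : ℝ → F := fun r => ψ (r • (σ : E))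
    have hh : ContDiff ℝ 1 h := hψ.comp (contDiff_id.smul contDiff_const)
    have hemb : Topology.IsClosedEmbedding fun r : ℝ => r • (σ : E) :=
      isClosedEmbedding_smul_left (norm_ne_zero_iff.1 (by rw [hσ]; exact one_ne_zero))
    have hhc : HasCompactSupport h := hc.comp_isClosedEmbedding hemb
    have hd : ∀ r, deriv h r = fderiv ℝ ψ (r • (σ : E)) σ := by
      intro r
      have h1 : HasDerivAt (fun r : ℝ => r • (σ : E)) (σ : E) r := by
        simpa using (hasDerivAt_id r).smul_const (σ : E)
      exact (((hψ.differentiable one_ne_zero _).hasFDerivAt).comp_hasDerivAt r h1).deriv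
    have h0 := hhc.integral_Ioi_deriv_eq hh 0
    simp only [h, zero_smul] at h0
    rw [← h0]
    refine setIntegral_congr_fun measurableSet_Ioi fun r (hr : 0 < r) => ?_
    have hr' : r ^ (Module.finrank ℝ E - 1) * ((r ^ Module.finrank ℝ E)⁻¹ * r) = 1 := by
      obtain ⟨k, hk⟩ := Nat.exists_eq_succ_of_ne_zero hpos.ne'
      rw [hk, Nat.succ_sub_one, pow_succ]
      field_simp
    change _ = deriv h r
    rw [hd r, norm_smul, hσ, mul_one, Real.norm_of_nonneg hr.le, map_smul, smul_smul, smul_smul,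
      mul_assoc, hr', one_smul]
  -- The inner integral does not depend on `σ`; the total mass of the sphere is `dim E` times the
  -- volume of the unit ball.
  simp only [key, integral_neg, integral_const, Measure.toSphere_real_apply_univ]

/-- Infinitesimal rotations are antisymmetric with respect to a radial weight. -/
theorem integral_radial_smul_rotation (μ : Measure E) [μ.IsAddHaarMeasure] {ψ : E → F}
    (hψ : ContDiff ℝ 1 ψ) (hc : HasCompactSupport ψ) {G k : E → ℝ} (hG : ContDiff ℝ 1 G)
    (hk : ∀ u w, fderiv ℝ G u w = k u * inner ℝ w u) (v w : E) :
    ∫ u, G u • (inner ℝ v u • fderiv ℝ ψ u w - inner ℝ w u • fderiv ℝ ψ u v) ∂μ = 0 := by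
  have hcd : ∀ w : E, HasCompactSupport fun u => fderiv ℝ ψ u w := fun w => hc.fderiv_apply ℝ w
  have hcont : ∀ w : E, Continuous fun u => fderiv ℝ ψ u w := fun w =>
    (hψ.continuous_fderiv one_ne_zero).clm_apply continuous_const
  have hprod : ∀ v : E, ContDiff ℝ 1 fun u => G u * inner ℝ v u := fun v =>
    hG.mul (contDiff_const.inner ℝ contDiff_id)
  have hder : ∀ v w u : E, fderiv ℝ (fun u => G u * inner ℝ v u) u w
      = G u * inner ℝ v w + inner ℝ v u * (k u * inner ℝ w u) := by
    intro v w u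
    have h1 := (hG.differentiable one_ne_zero u).hasFDerivAt
    have h2 := (innerSL ℝ v).hasFDerivAt (x := u)
    have h3 := (h1.mul h2).fderiv
    change fderiv ℝ (fun u => G u * inner ℝ v u) u = _ at h3
    rw [h3]
    simp [hk]
  have hint : ∀ v w : E, Integrable (fun u => (G u * inner ℝ v u) • fderiv ℝ ψ u w) μ :=
    fun v w => ((hprod v).continuous.smul (hcont w)).integrable_of_hasCompactSupport
      ((hcd w).smul_left)
  -- After integration by parts the factor multiplying `ψ` is symmetric in `v` and `w`, because the
  -- gradient of `G` is radial. The two halves of the rotation therefore cancel.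
  have hparts : ∀ v w : E, ∫ u, (G u * inner ℝ v u) • fderiv ℝ ψ u w ∂μ
      = -∫ u, (G u * inner ℝ v w + inner ℝ v u * (k u * inner ℝ w u)) • ψ u ∂μ := by
    intro v w
    simp only [← hder]
    refine integral_smul_fderiv_eq_neg_fderiv_smul_of_integrable ?_ (hint v w) ?_ ?_ ?_
    · exact ((((hprod v).continuous_fderiv one_ne_zero).clm_apply continuous_const).smul
        hψ.continuous).integrable_of_hasCompactSupport hc.smul_left
    · exact ((hprod v).continuous.smul hψ.continuous).integrable_of_hasCompactSupport hc.smul_left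
    · exact fun u _ => (hprod v).differentiable one_ne_zero u
    · exact fun u _ => hψ.differentiable one_ne_zero u
  simp only [smul_sub, smul_smul]
  rw [integral_sub (hint v w) (hint w v), hparts, hparts, sub_eq_zero]
  congr 2
  ext u
  rw [real_inner_comm v w]
  congr 1
  ring

theorem integrable_inv_norm_pow_smul_rotation [Nontrivial E] (μ : Measure E) [μ.IsAddHaarMeasure]
    {ψ : E → F} (hψ : ContDiff ℝ 1 ψ) (hc : HasCompactSupport ψ) (v w : E) :
    Integrable (fun u => (‖u‖ ^ Module.finrank ℝ E)⁻¹ •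
      (inner ℝ v u • fderiv ℝ ψ u w - inner ℝ w u • fderiv ℝ ψ u v)) μ := by
  simp only [smul_sub]
  exact (integrable_inv_norm_pow_smul_inner_smul_fderiv μ hψ hc v w).sub
    (integrable_inv_norm_pow_smul_inner_smul_fderiv μ hψ hc w v)

/-- Infinitesimal rotations are antisymmetric with respect to the singular weight `‖x‖⁻ⁿ` in
dimension `n`. -/
theorem integral_inv_norm_pow_smul_rotation [Nontrivial E] (μ : Measure E) [μ.IsAddHaarMeasure]
    {ψ : E → F} (hψ : ContDiff ℝ 1 ψ) (hc : HasCompactSupport ψ) (v w : E) :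
    ∫ u, (‖u‖ ^ Module.finrank ℝ E)⁻¹ •
      (inner ℝ v u • fderiv ℝ ψ u w - inner ℝ w u • fderiv ℝ ψ u v) ∂μ = 0 := by
  set N := Module.finrank ℝ E
  have hcont : ∀ w : E, Continuous fun u => fderiv ℝ ψ u w := fun w =>
    (hψ.continuous_fderiv one_ne_zero).clm_apply continuous_const
  let X : E → F := fun u => inner ℝ v u • fderiv ℝ ψ u w - inner ℝ w u • fderiv ℝ ψ u v
  have hX : Continuous X :=
    ((continuous_const.inner continuous_id).smul (hcont w)).sub
      ((continuous_const.inner continuous_id).smul (hcont v))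
  have hX0 : X 0 = 0 := by simp [X]
  have hXint : Integrable (fun u => (‖u‖ ^ N)⁻¹ • X u) μ :=
    integrable_inv_norm_pow_smul_rotation μ hψ hc v w
  -- The weight is regularized to `(‖u‖² + δ_j)^(-N/2)`, a function of `‖u‖²` that is smooth across
  -- the origin; dominated convergence then lets `δ_j` tend to `0`.
  let δ : ℕ → ℝ := fun j => 1 / ((j : ℝ) + 1)
  have hδ : ∀ j, 0 < δ j := fun j => Nat.one_div_pos_of_nat
  let g : ℕ → ℝ → ℝ := fun j s => (√(s + δ j) ^ N)⁻¹
  have hg : ∀ j (s : ℝ), 0 ≤ s → ContDiffAt ℝ 1 (g j) s := by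
    intro j s hs
    have h0 : 0 < s + δ j := by have := hδ j; linarith
    exact (((contDiffAt_id.add contDiffAt_const).sqrt h0.ne').pow N).inv
      (pow_ne_zero _ (Real.sqrt_pos.2 h0).ne')
  have hsq : ContDiff ℝ 1 fun u : E => ‖u‖ ^ 2 := contDiff_id.norm_sq ℝ
  have hzero : ∀ j, ∫ u, g j (‖u‖ ^ 2) • X u ∂μ = 0 := by
    intro j
    refine integral_radial_smul_rotation μ hψ hc (G := fun u => g j (‖u‖ ^ 2))
      (k := fun u => deriv (g j) (‖u‖ ^ 2) * 2) ?_ ?_ v w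
    · exact contDiff_iff_contDiffAt.2 fun u =>
        ContDiffAt.comp (g := g j) (f := fun u : E => ‖u‖ ^ 2) u (hg j _ (sq_nonneg _)) hsq.contDiffAt
    · intro u z
      have h1 := ((hg j _ (sq_nonneg ‖u‖)).differentiableAt one_ne_zero).hasDerivAt
      have h2 := (h1.comp_hasFDerivAt u (hasStrictFDerivAt_norm_sq u).hasFDerivAt).fderiv
      change fderiv ℝ (fun u => g j (‖u‖ ^ 2)) u = _ at h2
      rw [h2]
      simp [real_inner_comm, mul_assoc]
  have hlim : Tendsto (fun j => ∫ u, g j (‖u‖ ^ 2) • X u ∂μ) atTop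
      (𝓝 (∫ u, (‖u‖ ^ N)⁻¹ • X u ∂μ)) := by
    refine tendsto_integral_of_dominated_convergence (fun u => ‖(‖u‖ ^ N)⁻¹ • X u‖) ?_
      hXint.norm ?_ ?_
    · intro j
      refine Continuous.aestronglyMeasurable (Continuous.smul ?_ hX)
      exact continuous_iff_continuousAt.2 fun u =>
        ContinuousAt.comp (g := g j) (f := fun u : E => ‖u‖ ^ 2) (hg j _ (sq_nonneg _)).continuousAt
          hsq.continuous.continuousAt
    · refine fun j => .of_forall fun u => ?_
      -- At the origin the regularized weight is positive while the inverse `(0 ^ N)⁻¹` is `0`, so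
      -- the bound rests on `X 0 = 0`.
      rcases eq_or_ne u 0 with rfl | hu
      · simp [hX0]
      have hn : 0 < ‖u‖ := norm_pos_iff.2 hu
      rw [norm_smul, norm_smul]
      refine mul_le_mul_of_nonneg_right ?_ (norm_nonneg _)
      simp only [g, norm_inv, norm_pow, norm_norm, Real.norm_of_nonneg (Real.sqrt_nonneg _)]
      gcongr
      exact Real.le_sqrt_of_sq_le (by have := hδ j; linarith)
    · refine .of_forall fun u => ?_
      rcases eq_or_ne u 0 with rfl | hu
      · simp [hX0]
      have hn : 0 < ‖u‖ := norm_pos_iff.2 hu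
      refine Tendsto.smul_const ?_ _
      have h1 : Tendsto (fun j => ‖u‖ ^ 2 + δ j) atTop (𝓝 (‖u‖ ^ 2)) := by
        simpa [δ] using (tendsto_const_nhds (x := ‖u‖ ^ 2)).add
          (tendsto_one_div_add_atTop_nhds_zero_nat (𝕜 := ℝ))
      have h2 := ((h1.sqrt).pow N).inv₀ (by rw [Real.sqrt_sq hn.le]; positivity)
      rwa [Real.sqrt_sq hn.le] at h2
  simp only [hzero] at hlim
  exact (tendsto_nhds_unique hlim tendsto_const_nhds)

end Kernel

end Superanalysis

noncomputable section

namespace Superanalysis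

/-! ### Block decomposition and the pointwise algebraic identity. -/

theorem Blocks.mem_block_unique {q r : ℕ} (S : Blocks q r) {k k' : Fin r} {t : Fin q}
    (h : t ∈ S.block k) (h' : t ∈ S.block k') : k = k' := by
  simp only [Blocks.block, Finset.mem_filter, Finset.mem_univ, true_and] at h h'
  have aux : ∀ {k k' : Fin r}, k < k' → S.s k.succ ≤ S.s k'.castSucc := fun {k k'} hk =>
    S.strictMono.monotone (Fin.le_def.2 (by simpa using Nat.succ_le_of_lt (Fin.lt_def.1 hk)))
  rcases lt_trichotomy k k' with hk | hk | hk
  · have := aux hk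
    omega
  · exact hk
  · have := aux hk
    omega

theorem Blocks.exists_mem_block {q r : ℕ} (S : Blocks q r) (t : Fin q) : ∃ k, t ∈ S.block k := by
  have key : ∀ k : Fin (r + 1), (t : ℕ) < S.s k → ∃ k', t ∈ S.block k' := by
    intro k
    induction k using Fin.induction with
    | zero => intro h; rw [S.first] at h; omega
    | succ k ih =>
      intro h
      rcases lt_or_ge (t : ℕ) (S.s k.castSucc) with h1 | h1
      · exact ih h1
      · exact ⟨k, by simp [Blocks.block, h, h1]⟩
  exact key (Fin.last r) (by rw [S.last]; exact t.2)

theorem Blocks.tail_subset_block {q r : ℕ} (S : Blocks q r) (k : Fin r) :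
    S.tail k ⊆ S.block k := by
  intro t
  simp only [Blocks.block, Blocks.tail, Finset.mem_filter, Finset.mem_univ, true_and]
  omega

theorem Blocks.sum_block {q r : ℕ} (S : Blocks q r) {M : Type*} [AddCommMonoid M] (f : Fin q → M)
    (k : Fin r) : ∑ t ∈ S.block k, f t = f (S.head k) + ∑ t ∈ S.tail k, f t := by
  have hb : S.block k = insert (S.head k) (S.tail k) := by
    ext t
    have h1 : S.s k.castSucc < S.s k.succ := S.strictMono Fin.castSucc_lt_succ
    simp only [Blocks.block, Blocks.tail, Blocks.head, Finset.mem_filter, Finset.mem_univ,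
      true_and, Finset.mem_insert, Fin.ext_iff]
    omega
  rw [hb, Finset.sum_insert (by simp [Blocks.tail, Blocks.head])]

theorem Blocks.sum_eq {q r : ℕ} (S : Blocks q r) {M : Type*} [AddCommMonoid M] (f : Fin q → M) :
    ∑ t, f t = ∑ k, (f (S.head k) + ∑ t ∈ S.tail k, f t) := by
  classical
  have hu : (Finset.univ : Finset (Fin q)) = Finset.univ.biUnion S.block := by
    ext t
    simpa using S.exists_mem_block t
  rw [hu, Finset.sum_biUnion]
  · exact Finset.sum_congr rfl fun k _ => S.sum_block f k
  · intro k _ k' _ hkk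
    exact Finset.disjoint_left.2 fun t h h' => hkk (S.mem_block_unique h h')

/-- The pointwise identity behind the fundamental solution: the product of the Cauchy–Riemann
operators of one block with the conjugate coordinates is the Euler field of the block plus
rotations. -/
theorem sum_cauchyRiemann_mul {Λ : Type*} [Ring Λ] [Algebra ℝ Λ] {ι : Type*} (s : Finset ι)
    (a D : ι → Λ) (X : ι → ℝ) (D₀ : Λ) (X₀ : ℝ) (ha : 1 + ∑ t ∈ s, a t ^ 2 = 0)
    (hcomm : ∀ t y, a t * y = y * a t) :
    ∑ t ∈ s, (D t - a t * D₀) * (X t • (1 : Λ) + X₀ • a t)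
      = (X₀ • D₀ + ∑ t ∈ s, X t • D t) + ∑ t ∈ s, a t * (X₀ • D t - X t • D₀) := by
  have h1 : ∀ t, (D t - a t * D₀) * (X t • (1 : Λ) + X₀ • a t)
      = X t • D t + a t * (X₀ • D t - X t • D₀) - X₀ • (a t ^ 2 * D₀) := by
    intro t
    simp only [mul_add, sub_mul, mul_sub, mul_smul_comm, mul_one, pow_two, smul_sub]
    rw [← hcomm t (D t), ← hcomm t (a t * D₀), mul_assoc]
    abel
  -- The quadratic terms, summed with `∑ a_t² = -1`, supply the term `X₀ D₀` missing from the Euler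
  -- field.
  have h2 : ∑ t ∈ s, X₀ • (a t ^ 2 * D₀) = -(X₀ • D₀) := by
    rw [← Finset.smul_sum, ← Finset.sum_mul, eq_neg_of_add_eq_zero_right ha, neg_one_mul, smul_neg]
  simp only [h1]
  rw [Finset.sum_sub_distrib, Finset.sum_add_distrib, h2]
  abel

/-! ### Coordinates, and coefficients of exterior products. -/

section

variable {Λ : Type*} [NormedRing Λ] [NormedAlgebra ℝ Λ]
variable {𝒜 : ZMod 2 → Submodule ℝ Λ} {n m p q r d : ℕ}
variable (e : Module.Basis (Fin (p + 1)) ℝ (𝒜 0)) (ε : Module.Basis (Fin q) ℝ (𝒜 1))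

variable (hd : n * (p + 1) + m * q = d + 1)

/-- The map `point` as a continuous linear map. -/
def pointCLM : EuclideanSpace ℝ (Fin (d + 1)) →L[ℝ] Superspace 𝒜 n m :=
  ∑ b, (EuclideanSpace.proj b : EuclideanSpace ℝ (Fin (d + 1)) →L[ℝ] ℝ).smulRight
    (coordVec e ε ((position hd).symm b))

theorem pointCLM_apply (u : EuclideanSpace ℝ (Fin (d + 1))) :
    pointCLM e ε hd u = point e ε hd u := by
  simp [pointCLM, point]

theorem pointCLM_single (b : Fin (d + 1)) :
    pointCLM e ε hd (EuclideanSpace.single b 1) = coordVec e ε ((position hd).symm b) := by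
  rw [pointCLM_apply, point, Finset.sum_eq_single b]
  · simp
  · intro b' _ hb
    simp [hb]
  · simp

variable [FiniteDimensional ℝ Λ]

theorem coord_coordVec (c c' : Label n m p q) :
    coord e ε c (coordVec e ε c') = if c = c' then 1 else 0 := by
  rcases c with ⟨i, j⟩ | ⟨l, t⟩ <;> rcases c' with ⟨i', j'⟩ | ⟨l', t'⟩
  · by_cases h : i = i'
    · subst h
      simp [coord, coordVec, Finsupp.single_apply, eq_comm]
    · simp [coord, coordVec, h]
  · simp [coord, coordVec]
  · simp [coord, coordVec]
  · by_cases h : l = l'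
    · subst h
      simp [coord, coordVec, Finsupp.single_apply, eq_comm]
    · simp [coord, coordVec, h]

theorem coord_point (c : Label n m p q) (u : EuclideanSpace ℝ (Fin (d + 1))) :
    coord e ε c (point e ε hd u) = u (position hd c) := by
  simp only [point, map_sum, map_smul, coord_coordVec, Equiv.eq_symm_apply, smul_eq_mul, mul_ite,
    mul_one, mul_zero]
  simp

theorem euclNorm_point (u : EuclideanSpace ℝ (Fin (d + 1))) :
    euclNorm e ε (point e ε hd u) = ‖u‖ := by
  simp only [euclNorm, coord_point, EuclideanSpace.norm_eq, Real.norm_eq_abs, sq_abs]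
  rw [(position hd).sum_comp fun b => u b ^ 2]

theorem pointCLM_isClosedEmbedding : Topology.IsClosedEmbedding (pointCLM e ε hd) := by
  refine LinearMap.isClosedEmbedding_of_injective (f := (pointCLM e ε hd).toLinearMap) ?_
  refine LinearMap.ker_eq_bot.2 fun u v huv => ?_
  ext b
  have h := congrArg (coord e ε ((position hd).symm b)) huv
  simpa [pointCLM_apply, coord_point] using h

theorem hatForm_removeNth (c : Label n m p q) (i : Fin (d + 1)) :
    hatForm e ε hd c (i.removeNth fun b => coordVec e ε ((position hd).symm b))
      = if i = position hd c then 1 else 0 := by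
  have h : hatForm e ε hd c (i.removeNth fun b => coordVec e ε ((position hd).symm b))
      = algebraMap ℝ Λ (Matrix.det (Matrix.of fun b b' : Fin d =>
          if (position hd c).succAbove b' = i.succAbove b then (1 : ℝ) else 0)) := by
    change algebraMap ℝ Λ (Matrix.det (Matrix.of fun b b' : Fin d =>
      coord e ε ((position hd).symm ((position hd c).succAbove b'))
        (coordVec e ε ((position hd).symm (i.succAbove b))))) = _
    simp only [coord_coordVec, EmbeddingLike.apply_eq_iff_eq]
  rw [h]
  split_ifs with hi
  · subst hi
    have : (Matrix.of fun b b' : Fin d =>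
        if (position hd c).succAbove b' = (position hd c).succAbove b then (1 : ℝ) else 0) = 1 := by
      ext b b'
      simp [Matrix.one_apply, eq_comm]
    rw [this, Matrix.det_one, map_one]
  -- When another vector is removed, the one dual to the omitted coordinate remains and is killed by
  -- all the other coordinates: a zero row.
  · obtain ⟨b, hb⟩ := Fin.exists_succAbove_eq (x := position hd c) (y := i) (Ne.symm hi)
    rw [Matrix.det_eq_zero_of_row_eq_zero b, map_zero]
    intro b'
    simp [hb, Fin.succAbove_ne]

theorem wedgeOne_apply {k : ℕ} (l : Superspace 𝒜 n m →L[ℝ] Λ) (ω : ExtForm 𝒜 n m k)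
    (v : Fin (k + 1) → Superspace 𝒜 n m) :
    wedgeOne l ω v = ∑ i : Fin (k + 1), (-1 : ℝ) ^ (i : ℕ) • (l (v i) * ω (i.removeNth v)) := by
  rw [wedgeOne, ContinuousAlternatingMap.alternatizeUncurryFin_apply]
  refine Finset.sum_congr rfl fun i _ => ?_
  rw [← Int.cast_smul_eq_zsmul ℝ]
  push_cast
  rfl

/-- The coefficient of `l ∧ ω` in front of the orientation form. -/
def wedgeCoeff (l : Superspace 𝒜 n m →L[ℝ] Λ) : ExtForm 𝒜 n m d →ₗ[ℝ] Λ where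
  toFun ω := wedgeOne l ω fun b => coordVec e ε ((position hd).symm b)
  map_add' ω η := by simp [wedgeOne_apply, mul_add, Finset.sum_add_distrib]
  map_smul' c ω := by
    simp only [wedgeOne_apply, ContinuousAlternatingMap.smul_apply, mul_smul_comm, Finset.smul_sum,
      RingHom.id_apply]
    exact Finset.sum_congr rfl fun i _ => smul_comm _ _ _

/-- Only deleting the vector at the place of `c` leaves a nonzero minor; its sign is the one that
the sign prefactors of `Ω` undo. -/
theorem wedgeCoeff_smul_hatForm (l : Superspace 𝒜 n m →L[ℝ] Λ) (h : Λ) (c : Label n m p q) :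
    wedgeCoeff e ε hd l (h • hatForm e ε hd c)
      = (-1 : ℝ) ^ (position hd c : ℕ) • (l (coordVec e ε c) * h) := by
  change wedgeOne l (h • hatForm e ε hd c) _ = _
  simp only [wedgeOne_apply, ContinuousAlternatingMap.smul_apply, hatForm_removeNth]
  rw [Finset.sum_eq_single (position hd c)]
  · simp
  · intro b _ hb
    simp [hb]
  · simp

theorem partialForm_zeroForm {φ : Superspace 𝒜 n m → Λ} {x : Superspace 𝒜 n m}
    (hφ : DifferentiableAt ℝ φ x) (c : Label n m p q) (v : Fin 0 → Superspace 𝒜 n m) :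
    partialForm e ε c (zeroForm φ) x v = fderiv ℝ φ x (coordVec e ε c) := by
  let A : Λ →ₗ[ℝ] ExtForm 𝒜 n m 0 :=
    { toFun := ContinuousAlternatingMap.constOfIsEmpty ℝ (Superspace 𝒜 n m) (Fin 0)
      map_add' := fun _ _ => rfl
      map_smul' := fun _ _ => rfl }
  have hA : HasFDerivAt (LinearMap.toContinuousLinearMap A) (LinearMap.toContinuousLinearMap A)
      (φ x) := ContinuousLinearMap.hasFDerivAt _
  have h := (HasFDerivAt.comp (𝕜 := ℝ) (E := Superspace 𝒜 n m) (F := Λ) (G := ExtForm 𝒜 n m 0) x hA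
    hφ.hasFDerivAt).fderiv
  change fderiv ℝ (zeroForm φ) x = _ at h
  rw [partialForm, h]
  rfl

theorem wedgeOne_dcoord_apply (c c' : Label n m p q) (ω : ExtForm 𝒜 n m 0) :
    wedgeOne (dcoord e ε c) ω (fun _ => coordVec e ε c') = if c = c' then ω 0 else 0 := by
  have h0 : ∀ v : Fin 0 → Superspace 𝒜 n m, ω v = ω 0 := fun v => by
    rw [Subsingleton.elim v 0]
  simp only [wedgeOne_apply, h0]
  by_cases h : c = c' <;> simp [dcoord, coord_coordVec, h]

variable {e ε}
variable (S : Blocks q r) (a : Fin q → 𝒜 0)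

theorem dbar_zeroForm_inl {φ : Superspace 𝒜 n m → Λ} {x : Superspace 𝒜 n m}
    (hφ : DifferentiableAt ℝ φ x) (i : Fin n) (j : Fin p) :
    dbar e ε S a (zeroForm φ) x (fun _ => coordVec e ε (.inl (i, j.succ)))
      = fderiv ℝ φ x (coordVec e ε (.inl (i, j.succ)))
        - (e j.succ : Λ) * fderiv ℝ φ x (coordVec e ε (.inl (i, 0))) := by
  simp only [dbar, ContinuousAlternatingMap.add_apply, ContinuousAlternatingMap.sum_apply,
    wedgeOne_dcoord_apply, ContinuousAlternatingMap.sub_apply,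
    ContinuousAlternatingMap.smul_apply, partialForm_zeroForm e ε hφ, smul_eq_mul]
  rw [Finset.sum_eq_single i, Finset.sum_eq_single j]
  · simp
  · intro j' _ hj
    simp [hj]
  · simp
  · intro i' _ hi
    simp [hi]
  · simp

theorem dbar_zeroForm_inr {φ : Superspace 𝒜 n m → Λ} {x : Superspace 𝒜 n m}
    (hφ : DifferentiableAt ℝ φ x) (l : Fin m) {k : Fin r} {t : Fin q} (ht : t ∈ S.tail k) :
    dbar e ε S a (zeroForm φ) x (fun _ => coordVec e ε (.inr (l, t)))
      = fderiv ℝ φ x (coordVec e ε (.inr (l, t)))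
        - (a t : Λ) * fderiv ℝ φ x (coordVec e ε (.inr (l, S.head k))) := by
  simp only [dbar, ContinuousAlternatingMap.add_apply, ContinuousAlternatingMap.sum_apply,
    wedgeOne_dcoord_apply, ContinuousAlternatingMap.sub_apply,
    ContinuousAlternatingMap.smul_apply, partialForm_zeroForm e ε hφ, smul_eq_mul]
  rw [Finset.sum_eq_single l, Finset.sum_eq_single k, Finset.sum_eq_single t]
  · simp
  · intro t' _ h
    simp [h]
  · exact fun h => absurd ht h
  -- The index `t` lies in a single block, so the other blocks contribute nothing.
  · intro k' _ hk
    refine Finset.sum_eq_zero fun t' ht' => if_neg fun h => hk ?_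
    simp only [Sum.inr.injEq, Prod.mk.injEq, true_and] at h
    subst h
    exact S.mem_block_unique (S.tail_subset_block k' ht') (S.tail_subset_block k ht)
  · simp
  · intro l' _ h
    simp [h]
  · simp

theorem position_inl (i : Fin n) (j : Fin (p + 1)) :
    (position hd (.inl (i, j) : Label n m p q) : ℕ) = (p + 1) * i + j := by
  simp [position, add_comm]

/-- The summand `q * l` is absent from the sign exponent in `fundForm`; it is harmless exactly
because `q` is even. -/
theorem position_inr (l : Fin m) (t : Fin q) :
    (position hd (.inr (l, t) : Label n m p q) : ℕ) = n * (p + 1) + (t + q * l) := by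
  simp [position]

end

end Superanalysis

end

/-! ### The density of `d''φ ∧ Ω` and its integral. -/

noncomputable section

namespace Superanalysis

open MeasureTheory

section

variable {Λ : Type*} [NormedRing Λ] [NormedAlgebra ℝ Λ] {n m p q d : ℕ}
variable (hd : n * (p + 1) + m * q = d + 1)

/-- The rotation field `x_c ∂_{c'} - x_{c'} ∂_c` applied to a function. -/
def rotation (ψ : EuclideanSpace ℝ (Fin (d + 1)) → Λ) (c c' : Label n m p q)
    (u : EuclideanSpace ℝ (Fin (d + 1))) : Λ :=
  u (position hd c) • fderiv ℝ ψ u (EuclideanSpace.single (position hd c') 1)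
    - u (position hd c') • fderiv ℝ ψ u (EuclideanSpace.single (position hd c) 1)

theorem integrable_rotation {ψ : EuclideanSpace ℝ (Fin (d + 1)) → Λ} (hψ : ContDiff ℝ 1 ψ)
    (hc : HasCompactSupport ψ) (c c' : Label n m p q) :
    Integrable fun u => (‖u‖ ^ (d + 1))⁻¹ • rotation hd ψ c c' u := by
  simpa [rotation, EuclideanSpace.inner_single_left] using
    integrable_inv_norm_pow_smul_rotation volume hψ hc (EuclideanSpace.single (position hd c) 1)
      (EuclideanSpace.single (position hd c') 1)

theorem integral_rotation {ψ : EuclideanSpace ℝ (Fin (d + 1)) → Λ} (hψ : ContDiff ℝ 1 ψ)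
    (hc : HasCompactSupport ψ) (c c' : Label n m p q) :
    ∫ u, (‖u‖ ^ (d + 1))⁻¹ • rotation hd ψ c c' u = 0 := by
  simpa [rotation, EuclideanSpace.inner_single_left] using
    integral_inv_norm_pow_smul_rotation volume hψ hc (EuclideanSpace.single (position hd c) 1)
      (EuclideanSpace.single (position hd c') 1)

end

section

variable {Λ : Type*} [NormedRing Λ] [NormedAlgebra ℝ Λ] [FiniteDimensional ℝ Λ]
variable {𝒜 : ZMod 2 → Submodule ℝ Λ} {n m p q r d : ℕ}
variable (e : Module.Basis (Fin (p + 1)) ℝ (𝒜 0)) (ε : Module.Basis (Fin q) ℝ (𝒜 1))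
variable (S : Blocks q r) (a : Fin q → 𝒜 0) (hd : n * (p + 1) + m * q = d + 1)

theorem locallyIntegrable_fundForm (v : Fin d → Superspace 𝒜 n m) :
    LocallyIntegrable fun u : EuclideanSpace ℝ (Fin (d + 1)) =>
      fundForm e ε S a hd (point e ε hd u) v := by
  have hN : n * (p + 1) + q * m = Module.finrank ℝ (EuclideanSpace ℝ (Fin (d + 1))) := by
    rw [finrank_euclideanSpace_fin, ← hd, mul_comm q m]
  -- Evaluated on fixed vectors, the bracket in `Ω` is linear in `x`, so each coefficient is a
  -- linear field over `‖x‖ᴺ`.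
  let A : Superspace 𝒜 n m →L[ℝ] Λ :=
    (∑ i : Fin n, ∑ j : Fin p, (-1 : ℝ) ^ ((p + 1) * (i : ℕ) + (j.succ : ℕ)) •
      ((coord e ε (.inl (i, j.succ))).smulRight (hatForm e ε hd (.inl (i, j.succ)) v)
        + (coord e ε (.inl (i, 0))).smulRight
            ((e j.succ : Λ) * hatForm e ε hd (.inl (i, j.succ)) v)))
    + ∑ l : Fin m, ∑ k : Fin r, ∑ t ∈ S.tail k, (-1 : ℝ) ^ (n * (p + 1) + (t : ℕ)) •
      ((coord e ε (.inr (l, t))).smulRight (hatForm e ε hd (.inr (l, t)) v)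
        + (coord e ε (.inr (l, S.head k))).smulRight
            ((a t : Λ) * hatForm e ε hd (.inr (l, t)) v))
  have h := (locallyIntegrable_inv_norm_pow_smul (volume : Measure (EuclideanSpace ℝ (Fin (d + 1))))
    (A.comp (pointCLM e ε hd))).smul (fundConst n m p q d)
  refine (congrArg (fun f => LocallyIntegrable f volume) (funext fun u => ?_)).mpr h
  simp only [fundForm, euclNorm_point, Pi.smul_apply, ContinuousLinearMap.comp_apply,
    pointCLM_apply, ← hN, smul_smul, div_eq_mul_inv, ContinuousAlternatingMap.smul_apply]
  congr 1
  simp only [A, ContinuousAlternatingMap.add_apply, ContinuousAlternatingMap.sum_apply,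
    ContinuousAlternatingMap.smul_apply, _root_.add_apply,
    _root_.sum_apply, _root_.smul_apply,
    ContinuousLinearMap.smulRight_apply, add_mul, smul_mul_assoc, one_mul, smul_eq_mul, smul_add]

variable {e ε S a} [GradedAlgebra 𝒜]

/-- The density of `d''φ ∧ Ω`: the Euler field plus rotations with coefficients in `Λ₀`, divided by
the norm to the power of the dimension. -/
theorem wedge_dbar_fundForm (hsc : IsSupercommutative 𝒜) (hA0 : ConditionA0 e)
    (hA1 : 0 < m → ConditionA1 ε S a) {φ : Superspace 𝒜 n m → Λ} (hφ : Differentiable ℝ φ)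
    (u : EuclideanSpace ℝ (Fin (d + 1))) :
    wedgeOne ((ContinuousAlternatingMap.ofSubsingleton ℝ (Superspace 𝒜 n m) Λ (0 : Fin 1)).symm
        (dbar e ε S a (zeroForm φ) (point e ε hd u))) (fundForm e ε S a hd (point e ε hd u))
        (fun b => coordVec e ε ((position hd).symm b))
      = fundConst n m p q d • ((‖u‖ ^ (d + 1))⁻¹ • fderiv ℝ (φ ∘ point e ε hd) u u
        + (∑ i : Fin n, ∑ j : Fin p, (e j.succ : Λ) * ((‖u‖ ^ (d + 1))⁻¹ •
            rotation hd (φ ∘ point e ε hd) (.inl (i, 0)) (.inl (i, j.succ)) u)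
          + ∑ l : Fin m, ∑ k : Fin r, ∑ t ∈ S.tail k, (a t : Λ) * ((‖u‖ ^ (d + 1))⁻¹ •
            rotation hd (φ ∘ point e ε hd) (.inr (l, S.head k)) (.inr (l, t)) u))) := by
  set x := point e ε hd u with hx
  set η := (ContinuousAlternatingMap.ofSubsingleton ℝ (Superspace 𝒜 n m) Λ (0 : Fin 1)).symm
    (dbar e ε S a (zeroForm φ) x) with hη
  let D : Label n m p q → Λ := fun c => fderiv ℝ φ x (coordVec e ε c)
  let X : Label n m p q → ℝ := fun c => u (position hd c)
  have hηv : ∀ v, η v = dbar e ε S a (zeroForm φ) x fun _ => v := fun v => rfl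
  have hq : Even q := hA0.even_odd_dim hsc ε
  have hN : n * (p + 1) + q * m = d + 1 := by rw [← hd, mul_comm q m]
  have hfd : ∀ w, fderiv ℝ (φ ∘ point e ε hd) u w = fderiv ℝ φ x (pointCLM e ε hd w) := by
    intro w
    have h0 : point e ε hd = pointCLM e ε hd := funext fun u => (pointCLM_apply e ε hd u).symm
    have h1 : HasFDerivAt φ (fderiv ℝ φ x) (pointCLM e ε hd u) := by
      rw [pointCLM_apply]
      exact (hφ x).hasFDerivAt
    have h2 := (HasFDerivAt.comp (𝕜 := ℝ) (E := EuclideanSpace ℝ (Fin (d + 1)))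
      (F := Superspace 𝒜 n m) (G := Λ) u h1 (pointCLM e ε hd).hasFDerivAt).fderiv
    rw [h0, h2]
    rfl
  have hD : ∀ c, fderiv ℝ (φ ∘ point e ε hd) u (EuclideanSpace.single (position hd c) 1) = D c := by
    intro c
    rw [hfd, pointCLM_single, Equiv.symm_apply_apply]
  have hEuler : fderiv ℝ (φ ∘ point e ε hd) u u = ∑ c, X c • D c := by
    rw [hfd, pointCLM_apply, point, map_sum, ← (position hd).sum_comp]
    simp [X, D]
  have hleft : wedgeOne η (fundForm e ε S a hd x) (fun b => coordVec e ε ((position hd).symm b))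
      = (fundConst n m p q d / ‖u‖ ^ (d + 1)) •
        ((∑ i : Fin n, ∑ j : Fin p, (D (.inl (i, j.succ)) - (e j.succ : Λ) * D (.inl (i, 0))) *
            (X (.inl (i, j.succ)) • (1 : Λ) + X (.inl (i, 0)) • (e j.succ : Λ)))
          + ∑ l : Fin m, ∑ k : Fin r, ∑ t ∈ S.tail k,
            (D (.inr (l, t)) - (a t : Λ) * D (.inr (l, S.head k))) *
            (X (.inr (l, t)) • (1 : Λ) + X (.inr (l, S.head k)) • (a t : Λ))) := by
    change wedgeCoeff e ε hd η (fundForm e ε S a hd x) = _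
    rw [fundForm, map_smul, hx, euclNorm_point, hN, ← hx, map_add, map_sum, map_sum]
    congr 2
    · refine Finset.sum_congr rfl fun i _ => ?_
      rw [map_sum]
      refine Finset.sum_congr rfl fun j _ => ?_
      rw [map_smul, wedgeCoeff_smul_hatForm, position_inl, smul_smul, ← mul_pow, neg_one_mul,
        neg_neg, one_pow, one_smul, hηv, dbar_zeroForm_inl S a (hφ x), hx, coord_point, coord_point]
    · refine Finset.sum_congr rfl fun l _ => ?_
      rw [map_sum]
      refine Finset.sum_congr rfl fun k _ => ?_
      rw [map_sum]
      refine Finset.sum_congr rfl fun t ht => ?_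
      rw [map_smul, wedgeCoeff_smul_hatForm, position_inr, ← add_assoc, pow_add _ _ (q * (l : ℕ)),
        (hq.mul_right (l : ℕ)).neg_one_pow, mul_one, smul_smul, ← mul_pow, neg_one_mul,
        neg_neg, one_pow, one_smul, hηv, dbar_zeroForm_inr S a (hφ x) l ht, hx, coord_point,
        coord_point]
  have hy : ∀ i : Fin n, ∑ j : Fin p,
      (D (.inl (i, j.succ)) - (e j.succ : Λ) * D (.inl (i, 0))) *
        (X (.inl (i, j.succ)) • (1 : Λ) + X (.inl (i, 0)) • (e j.succ : Λ))
      = ∑ j, X (.inl (i, j)) • D (.inl (i, j))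
        + ∑ j : Fin p, (e j.succ : Λ) *
          rotation hd (φ ∘ point e ε hd) (.inl (i, 0)) (.inl (i, j.succ)) u := by
    intro i
    have h := hA0.2
    rw [Fin.sum_univ_succ, hA0.1, one_pow] at h
    rw [sum_cauchyRiemann_mul Finset.univ (fun j : Fin p => (e j.succ : Λ))
      (fun j => D (.inl (i, j.succ))) (fun j => X (.inl (i, j.succ))) _ _ h
      (fun j y => hsc.commute_of_even (e j.succ).2 y), Fin.sum_univ_succ]
    simp only [rotation, hD, X]
  have hθ : ∀ l : Fin m, ∑ k : Fin r, ∑ t ∈ S.tail k,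
      (D (.inr (l, t)) - (a t : Λ) * D (.inr (l, S.head k))) *
        (X (.inr (l, t)) • (1 : Λ) + X (.inr (l, S.head k)) • (a t : Λ))
      = ∑ t, X (.inr (l, t)) • D (.inr (l, t))
        + ∑ k : Fin r, ∑ t ∈ S.tail k, (a t : Λ) *
          rotation hd (φ ∘ point e ε hd) (.inr (l, S.head k)) (.inr (l, t)) u := by
    intro l
    -- The existence of an index `l` forces `m ≥ 1`, so condition `(A₁)` is available.
    have hA := hA1 l.pos
    rw [S.sum_eq, ← Finset.sum_add_distrib]
    refine Finset.sum_congr rfl fun k _ => ?_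
    have h := hA.sum_sq k
    rw [S.sum_block, hA.head_eq_one, one_pow] at h
    rw [sum_cauchyRiemann_mul (S.tail k) (fun t => (a t : Λ))
      (fun t => D (.inr (l, t))) (fun t => X (.inr (l, t))) _ _ h
      (fun t y => hsc.commute_of_even (a t).2 y)]
    simp only [rotation, hD, X]
  rw [hleft, hEuler, Fintype.sum_sum_type, Fintype.sum_prod_type, Fintype.sum_prod_type,
    div_eq_mul_inv, mul_smul]
  congr 1
  simp only [hy, hθ, Finset.sum_add_distrib, mul_smul_comm, ← Finset.smul_sum, ← smul_add]
  congr 1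
  abel

theorem fundConst_mul_neg (hd : n * (p + 1) + m * q = d + 1) :
    fundConst n m p q d * -(((d + 1 : ℕ) : ℝ) *
      volume.real (Metric.ball (0 : EuclideanSpace ℝ (Fin (d + 1))) 1)) = 1 := by
  have hv : 0 < volume.real (Metric.ball (0 : EuclideanSpace ℝ (Fin (d + 1))) 1) :=
    ENNReal.toReal_pos (Metric.measure_ball_pos _ _ one_pos).ne' measure_ball_lt_top.ne
  rw [fundConst, mul_comm q m, hd, neg_mul_neg]
  exact inv_mul_cancel₀ (by positivity)

theorem integral_dbar_wedge_fundForm (hsc : IsSupercommutative 𝒜) (hA0 : ConditionA0 e)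
    (hA1 : 0 < m → ConditionA1 ε S a) {φ : Superspace 𝒜 n m → Λ} (hφ : ContDiff ℝ 1 φ)
    (hc : HasCompactSupport φ) :
    dbarCurrent e ε S a (currentOf e ε hd (fundForm e ε S a hd)) φ = φ 0 := by
  have h0 : φ ∘ point e ε hd = φ ∘ pointCLM e ε hd :=
    funext fun u => congrArg φ (pointCLM_apply e ε hd u).symm
  have hψ : ContDiff ℝ 1 (φ ∘ point e ε hd) := by
    rw [h0]
    exact ContDiff.comp (𝕜 := ℝ) (E := EuclideanSpace ℝ (Fin (d + 1))) (F := Superspace 𝒜 n m)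
      hφ (ContinuousLinearMap.contDiff _)
  have hψc : HasCompactSupport (φ ∘ point e ε hd) := by
    rw [h0]
    exact hc.comp_isClosedEmbedding (pointCLM_isClosedEmbedding e ε hd)
  simp only [dbarCurrent, currentOf, integralForm,
    wedge_dbar_fundForm hd hsc hA0 hA1 (hφ.differentiable one_ne_zero)]
  have hE := integrable_inv_norm_pow_smul_fderiv_self
    (volume : Measure (EuclideanSpace ℝ (Fin (d + 1)))) hψ hψc
  have hEi := integral_inv_norm_pow_smul_fderiv_self
    (volume : Measure (EuclideanSpace ℝ (Fin (d + 1)))) hψ hψc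
  rw [finrank_euclideanSpace_fin] at hE hEi
  have hR : ∀ (b : Λ) (c c' : Label n m p q), Integrable fun u =>
      b * ((‖u‖ ^ (d + 1))⁻¹ • rotation hd (φ ∘ point e ε hd) c c' u) := fun b c c' =>
    (integrable_rotation hd hψ hψc c c').const_mul b
  -- The factors `e_j` and `a_t` are constant and stand on the left, so they come out of the
  -- integral of a rotation, which is zero.
  have hRi : ∀ (b : Λ) (c c' : Label n m p q),
      ∫ u, b * ((‖u‖ ^ (d + 1))⁻¹ • rotation hd (φ ∘ point e ε hd) c c' u) = 0 := fun b c c' => by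
    rw [integral_const_mul_of_integrable (integrable_rotation hd hψ hψc c c'),
      integral_rotation hd hψ hψc, mul_zero]
  have hy := integrable_finsetSum Finset.univ fun (i : Fin n) _ =>
    integrable_finsetSum Finset.univ fun (j : Fin p) _ =>
      hR (e j.succ : Λ) (.inl (i, 0)) (.inl (i, j.succ))
  have hθ := integrable_finsetSum Finset.univ fun (l : Fin m) _ =>
    integrable_finsetSum Finset.univ fun (k : Fin r) _ =>
      integrable_finsetSum (S.tail k) fun t _ =>
        hR (a t : Λ) (.inr (l, S.head k)) (.inr (l, t))
  rw [integral_smul, integral_add hE (hy.fun_add hθ), integral_add hy hθ, hEi,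
    integral_finsetSum _ fun i _ => integrable_finsetSum _ fun j _ => hR _ _ _,
    integral_finsetSum _ fun l _ => integrable_finsetSum _ fun k _ =>
      integrable_finsetSum _ fun t _ => hR _ _ _,
    Finset.sum_eq_zero, Finset.sum_eq_zero, add_zero, add_zero, ← neg_smul, smul_smul,
    fundConst_mul_neg hd, one_smul]
  · simp [point]
  · intro l _
    rw [integral_finsetSum _ fun k _ => integrable_finsetSum _ fun t _ => hR _ _ _]
    refine Finset.sum_eq_zero fun k _ => ?_
    rw [integral_finsetSum _ fun t _ => hR _ _ _]
    exact Finset.sum_eq_zero fun t _ => hRi _ _ _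
  · intro i _
    rw [integral_finsetSum _ fun j _ => hR _ _ _]
    exact Finset.sum_eq_zero fun j _ => hRi _ _ _

end

end Superanalysis

end

theorem mainTheorem2 {Λ : Type*} [NormedRing Λ] [NormedAlgebra ℝ Λ] [FiniteDimensional ℝ Λ]
    (𝒜 : ZMod 2 → Submodule ℝ Λ) [GradedAlgebra 𝒜]
    (hsc : Superanalysis.IsSupercommutative 𝒜)
    {n m p q r d : ℕ} (hd : n * (p + 1) + m * q = d + 1)
    (e : Module.Basis (Fin (p + 1)) ℝ (𝒜 0)) (hA0 : Superanalysis.ConditionA0 e)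
    (ε : Module.Basis (Fin q) ℝ (𝒜 1)) (S : Superanalysis.Blocks q r) (a : Fin q → 𝒜 0)
    (hA1 : 0 < m → Superanalysis.ConditionA1 ε S a) :
    Superanalysis.IsFundamentalSolution e ε S a hd
      (Superanalysis.fundForm (n := n) (m := m) e ε S a hd) where
  locallyIntegrable := Superanalysis.locallyIntegrable_fundForm e ε S a hd
  dbar_eq _ hφ hc := Superanalysis.integral_dbar_wedge_fundForm hd hsc hA0 hA1
    (hφ.of_le (by exact_mod_cast le_top)) hc
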